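/- **Lemma 3.4 (Boolean model).** Let $d\ge 1$. A configuration is a locally finite, (extended) non-negative integer-valued Borel measure $\xi$ on $\mathbb{R}^d$ (Euclidean norm) with $\xi(\{x\})\le 1$ for all $x$; it is identified with its set of points. A point process on $\mathbb{R}^d$ is a random configuration. For a point process $\Xi$ with restrictions $\Xi_A(\cdot):=\Xi(A\cap\cdot)$ and Borel sets $A,B\subseteq\mathbb{R}^d$, let $$\beta_{A,B}:=\tfrac12\int\!\!\int\big|\mathbb{P}(\Xi_A\in d\zeta_1,\Xi_B\in d\zeta_2)-\mathbb{P}(\Xi_A\in d\zeta_1)\,\mathbb{P}(\Xi_B\in d\zeta_2)\big|,$$ that is, half of the total variation of the difference between the joint law of $(\Xi_A,\Xi_B)$ and the product of their laws. Let $\mathrm{diam}(A):=\sup\{\|x-y\|: x,y\in A\}$ and $d(A,B):=\inf\{\|x-y\|: x\in A,\ y\in B\}$, with $\sup\emptyset=0$ and $\inf\emptyset=\infty$. We say that $\Xi$ has exponentially decaying dependence (EDD) if there are constants $\theta_0\in[0,\infty)$ and $\theta_1,\theta_2,\theta_3,\theta_4\in(0,\infty)$ such that, for all Borel sets $A,B\subseteq\mathbb{R}^d$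 with $d(A,B)\ge\theta_3\ln\big(\mathrm{diam}(A)\vee\mathrm{diam}(B)\vee\theta_4\big)$, $$\beta_{A,B}\le\theta_1\big(\mathrm{diam}(A)^{\theta_0}\vee 1\big)\big(\mathrm{diam}(B)^{\theta_0}\vee 1\big)e^{-\theta_2 d(A,B)}$$ (with the conventions $\ln\infty=\infty$, $e^{-\infty}=0$, $\infty\cdot 0=0$). Let $\{X_n\}_{n\in\mathbb{N}}$ be random points (germs) of $\mathbb{R}^d$ such that $\sum_{n}\delta_{X_n}$ is a stationary Poisson point process, and let $\{\Xi(n)\}_{n\in\mathbb{N}}$ (grains) be i.i.d. point processes on $\mathbb{R}^d$, independent of $\{X_n\}_{n\in\mathbb{N}}$. Let $\Xi$ be a point process with $\Xi=\bigcup_{n\in\mathbb{N}}(X_n+\Xi(n))$ almost surely (the Boolean model). Suppose that there are positive constants $r_0,C_1,C_2$ such that $$\mathbb{P}\big(\Xi(n)\cap B(\mathbf{0},r)^c\ne\emptyset\big)\le C_1e^{-C_2r}\qquad\text{for all } r\ge r_0,$$ where $B(\mathbf{0},r)$ is the open ball of radius $r$ centred at the origin. Then $\Xi$ satisfies the EDD.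 -/

import Mathlib

open MeasureTheory ProbabilityTheory Set
open scoped ENNReal NNReal

/-- The space `ℝ^d` with its Euclidean norm. -/
abbrev Rd (d : ℕ) : Type := EuclideanSpace ℝ (Fin d)

/-- Configurations: locally finite measures on `ℝ^d` whose values are non-negative integers
(or `∞`, on unbounded sets) and that give mass at most one to every point. -/
structure IsConfiguration {d : ℕ} (ξ : Measure (Rd d)) : Prop where
  locallyFinite : IsLocallyFiniteMeasure ξ
  integerValued : ∀ B : Set (Rd d), MeasurableSet B → ∃ k : ℕ∞, ξ B = (k : ℝ≥0∞)
  simple : ∀ x : Rd d, ξ {x} ≤ 1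

/-- The set of points of a configuration. -/
def pointsOf {d : ℕ} (ξ : Measure (Rd d)) : Set (Rd d) := {x | ξ {x} ≠ 0}

/-- A point process on `ℝ^d`: a random element that takes its values in the space of
configurations, up to a null set. The σ-algebra on measures is the one generated by the evaluations
`ξ ↦ ξ B`, `B` Borel; on configurations it is the Borel σ-algebra of the vague topology. -/
structure IsPointProcess {d : ℕ} {Ω : Type*} [MeasurableSpace Ω] (P : Measure Ω)
    (Ξ : Ω → Measure (Rd d)) : Prop where
  measurable : Measurable Ξ
  isConfiguration : ∀ᵐ ω ∂P, IsConfiguration (Ξ ω)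

/-- Stationarity: for every `x`, the shifted process `Ξ^x`, `Ξ^x (B) = Ξ (B + x)`, has the same
law as `Ξ`. -/
def IsStationaryProcess {d : ℕ} {Ω : Type*} [MeasurableSpace Ω] (P : Measure Ω)
    (Ξ : Ω → Measure (Rd d)) : Prop :=
  ∀ x : Rd d, IdentDistrib (fun ω => (Ξ ω).map (fun y => y - x)) Ξ P P

/-- A Poisson process: for some locally finite intensity measure `Λ`, the number of points in a
Borel set `B` with `Λ B < ∞` is Poisson with mean `Λ B`, and the numbers of points in finitely many
pairwise disjoint Borel sets are independent. -/
def IsPoissonProcess {d : ℕ} {Ω : Type*} [MeasurableSpace Ω] (P : Measure Ω)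
    (N : Ω → Measure (Rd d)) : Prop :=
  ∃ Λ : Measure (Rd d), IsLocallyFiniteMeasure Λ ∧
    (∀ B : Set (Rd d), MeasurableSet B → Λ B < ∞ →
      P.map (fun ω => N ω B) =
        (poissonMeasure (Λ B).toNNReal).map (fun k : ℕ => (k : ℝ≥0∞))) ∧
    (∀ (n : ℕ) (B : Fin n → Set (Rd d)), (∀ i, MeasurableSet (B i)) →
      (∀ i j, i ≠ j → Disjoint (B i) (B j)) →
      iIndepFun (fun i ω => N ω (B i)) P)

/-- The process of germs `∑ n, δ_{X n}`. -/
noncomputable def germProcess {d : ℕ} {Ω : Type*} (X : ℕ → Ω → Rd d) (ω : Ω) :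
    Measure (Rd d) :=
  Measure.sum (fun n => Measure.dirac (X n ω))

/-- The germ-grain model `Ξ = ⋃ n, (X n + G n)` with germs `X n` and grains `G n`. -/
structure IsGermGrainModel {d : ℕ} {Ω : Type*} [MeasurableSpace Ω] (P : Measure Ω)
    (X : ℕ → Ω → Rd d) (G : ℕ → Ω → Measure (Rd d)) (Ξ : Ω → Measure (Rd d)) : Prop where
  germ_measurable : ∀ n, Measurable (X n)
  germ_isPointProcess : IsPointProcess P (germProcess X)
  germ_isStationary : IsStationaryProcess P (germProcess X)
  grain_isPointProcess : ∀ n, IsPointProcess P (G n)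
  grain_iIndepFun : iIndepFun G P
  grain_identDistrib : ∀ m n, IdentDistrib (G m) (G n) P P
  germ_indepFun_grain : IndepFun (fun ω n => X n ω) (fun ω n => G n ω) P
  isPointProcess : IsPointProcess P Ξ
  eq_union : ∀ᵐ ω ∂P, pointsOf (Ξ ω) = ⋃ n, (fun y => X n ω + y) '' pointsOf (G n ω)

/-- The Boolean model: a germ-grain model whose germs form a Poisson process. -/
structure IsBooleanModel {d : ℕ} {Ω : Type*} [MeasurableSpace Ω] (P : Measure Ω)
    (X : ℕ → Ω → Rd d) (G : ℕ → Ω → Measure (Rd d)) (Ξ : Ω → Measure (Rd d)) : Prop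
    extends IsGermGrainModel P X G Ξ where
  germ_isPoisson : IsPoissonProcess P (germProcess X)

/-- The `β`-mixing coefficient `β_{A,B}`: half of the total variation of the difference of the joint
law of the restrictions `(Ξ_A, Ξ_B)` and the product of their laws. -/
noncomputable def betaMixing {d : ℕ} {Ω : Type*} [MeasurableSpace Ω] (P : Measure Ω)
    [IsProbabilityMeasure P] (Ξ : Ω → Measure (Rd d)) (A B : Set (Rd d)) : ℝ≥0∞ :=
  ((P.map (fun ω => ((Ξ ω).restrict A, (Ξ ω).restrict B))).toSignedMeasure -
    ((P.map (fun ω => (Ξ ω).restrict A)).prod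
      (P.map (fun ω => (Ξ ω).restrict B))).toSignedMeasure).totalVariation univ / 2

/-- The distance of two sets, `∞` if one of them is empty. -/
noncomputable def setDist {d : ℕ} (A B : Set (Rd d)) : ℝ≥0∞ := ⨅ x ∈ A, ⨅ y ∈ B, edist x y

/-- Exponentially decaying dependence. Diameters and distances of sets may be infinite, so both
inequalities are stated for extended numbers (`log ∞ = ∞`, `exp (-∞) = 0`, `∞ * 0 = 0`). -/
def EDD {d : ℕ} {Ω : Type*} [MeasurableSpace Ω] (P : Measure Ω) [IsProbabilityMeasure P]
    (Ξ : Ω → Measure (Rd d)) : Prop :=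
  ∃ θ₀ θ₁ θ₂ θ₃ θ₄ : ℝ, 0 ≤ θ₀ ∧ 0 < θ₁ ∧ 0 < θ₂ ∧ 0 < θ₃ ∧ 0 < θ₄ ∧
    ∀ A B : Set (Rd d), MeasurableSet A → MeasurableSet B →
      (θ₃ : EReal) *
          ENNReal.log (max (max (Metric.ediam A) (Metric.ediam B)) (ENNReal.ofReal θ₄)) ≤
        (setDist A B : EReal) →
      betaMixing P Ξ A B ≤
        ENNReal.ofReal θ₁ * max (Metric.ediam A ^ θ₀) 1 * max (Metric.ediam B ^ θ₀) 1 *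
          EReal.exp (-((θ₂ : EReal) * (setDist A B : EReal)))

/-!
Fix nonempty bounded `A`, `B`, and let `A'`, `B'` be their neighbourhoods of radius half the
distance of `A` and `B`; these are disjoint. If no germ outside `A'` has a grain that reaches `A`,
then the model restricted to `A` depends only on the germs in `A'` and their grains, and likewise
for `B`. Marked Poisson germs over disjoint regions are independent, so `β_{A,B}` is at most twice
the sum of the probabilities that a far germ reaches `A`, respectively `B`
(`betaMixing_le_of_coupling`). By Campbell's formula and stationarity the first of them is at most
the integral of `c * C * exp (-C₂ * dist x A)` over the complement of `A'`, hence at most a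
polynomial in the diameter times an exponential in the distance
(`exists_lintegral_exp_neg_infDist_le`).

The truncated model is never built as a random measure. A configuration is a fixed measurable
function of the family of Borel sets that it hits (`IsConfiguration.eq_countOfHits`), and the
hitting indicators make sense for the germs in `A'` alone (`germsHit`). The avoidance events of
such a family form a π-system, so independence over `A'` and `B'` reduces to a product formula for
avoidance probabilities (`measure_avoid_and_avoid`). Conditionally on the germs these are products
over the germs, that is, exponentials of integrals against the germ process restricted to `A'` or
`B'`, and the two restrictions of a Poisson process are independent
(`IsPoissonProcess.indepFun_restrict`).
-/

/-! ### Configurations and the sets they hit -/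

/-- A configuration charges no set without points: locally its mass is an integer below one. -/
theorem IsConfiguration.measure_eq_zero_of_disjoint {d : ℕ} {ξ : Measure (Rd d)}
    (hξ : IsConfiguration ξ) {B : Set (Rd d)} (h : Disjoint (pointsOf ξ) B) : ξ B = 0 := by
  have := hξ.locallyFinite
  refine measure_null_of_locally_null B fun x hx => ?_
  have hx0 : ξ {x} = 0 := by
    by_contra hne
    exact Set.disjoint_left.1 h hne hx
  -- a neighbourhood of mass below one has mass zero
  obtain ⟨U, hxU, hUo, hU⟩ : ∃ U : Set (Rd d), x ∈ U ∧ IsOpen U ∧ ξ U < 1 := by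
    obtain ⟨U, hU1, hU2, hU3⟩ := Set.exists_isOpen_lt_of_lt {x} (1 : ℝ≥0∞) (μ := ξ) (by simp [hx0])
    exact ⟨U, hU1 rfl, hU2, hU3⟩
  refine ⟨U, mem_nhdsWithin_of_mem_nhds (hUo.mem_nhds hxU), ?_⟩
  obtain ⟨k, hk⟩ := hξ.integerValued U hUo.measurableSet
  rw [hk] at hU ⊢
  have : k < 1 := by exact_mod_cast hU
  simpa using Order.lt_one_iff.1 this

theorem IsConfiguration.measure_ne_zero_iff {d : ℕ} {ξ : Measure (Rd d)} (hξ : IsConfiguration ξ)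
    {B : Set (Rd d)} : ξ B ≠ 0 ↔ (pointsOf ξ ∩ B).Nonempty := by
  constructor
  · intro h
    by_contra hne
    exact h (hξ.measure_eq_zero_of_disjoint
      (Set.disjoint_iff_inter_eq_empty.2 (Set.not_nonempty_iff_eq_empty.1 hne)))
  · rintro ⟨x, hx, hxB⟩ h0
    exact hx (measure_mono_null (Set.singleton_subset_iff.2 hxB) h0)

theorem IsConfiguration.one_le_of_ne_zero {d : ℕ} {ξ : Measure (Rd d)} (hξ : IsConfiguration ξ)
    {B : Set (Rd d)} (hB : MeasurableSet B) (h : ξ B ≠ 0) : 1 ≤ ξ B := by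
  obtain ⟨k, hk⟩ := hξ.integerValued B hB
  rw [hk] at h ⊢
  have hk0 : k ≠ 0 := by rintro rfl; simp at h
  exact_mod_cast Order.one_le_iff_ne_zero.2 hk0

theorem IsConfiguration.restrict {d : ℕ} {ξ : Measure (Rd d)} (hξ : IsConfiguration ξ)
    {A : Set (Rd d)} (hA : MeasurableSet A) : IsConfiguration (ξ.restrict A) where
  locallyFinite := by have := hξ.locallyFinite; infer_instance
  integerValued B hB := by
    rw [Measure.restrict_apply hB]
    exact hξ.integerValued _ (hB.inter hA)
  simple x := (Measure.restrict_apply_le _ _).trans (hξ.simple x)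

/-- The Borel sets of `ℝ^d`, as an index set. -/
abbrev BorelSets (d : ℕ) : Type := {B : Set (Rd d) // MeasurableSet B}

theorem measurableSet_coe_countableBasis {d : ℕ} (U : TopologicalSpace.countableBasis (Rd d)) :
    MeasurableSet (U : Set (Rd d)) :=
  (TopologicalSpace.isOpen_of_mem_countableBasis U.2).measurableSet

open Classical in
/-- The number of points in each Borel set, reconstructed from the hitting indicators `h` of a
configuration: the largest number of pairwise disjoint basic open sets `U` such that `B ∩ U` is
hit. -/
noncomputable def countOfHits {d : ℕ} (h : BorelSets d → Prop) (B : BorelSets d) : ℝ≥0∞ :=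
  ⨆ s : Finset (TopologicalSpace.countableBasis (Rd d)),
    if (s : Set (TopologicalSpace.countableBasis (Rd d))).PairwiseDisjoint
        (fun U => (U : Set (Rd d))) ∧
      ∀ U ∈ s, h ⟨B ∩ U, B.2.inter (measurableSet_coe_countableBasis U)⟩
    then (s.card : ℝ≥0∞) else 0

theorem measurable_countOfHits {d : ℕ} : Measurable (countOfHits (d := d)) := by
  have : Countable (TopologicalSpace.countableBasis (Rd d)) :=
    (TopologicalSpace.countable_countableBasis (Rd d)).to_subtype
  refine measurable_pi_iff.2 fun B => Measurable.iSup fun s => ?_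
  refine Measurable.ite ?_ measurable_const measurable_const
  refine measurableSet_setOfPred.2 (measurable_const.and ?_)
  refine Measurable.forall fun U => Measurable.forall fun _ => ?_
  exact measurable_pi_apply _

theorem countOfHits_congr {d : ℕ} {h h' : BorelSets d → Prop} (H : ∀ B, h B ↔ h' B) :
    countOfHits h = countOfHits h' := by
  rw [show h = h' from funext fun B => propext (H B)]

/-- A configuration is determined, through a fixed measurable map, by the sets that it hits. -/
theorem IsConfiguration.eq_countOfHits {d : ℕ} {ξ : Measure (Rd d)} (hξ : IsConfiguration ξ)
    (B : BorelSets d) : ξ B = countOfHits (fun C => ξ C ≠ 0) B := by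
  classical
  apply le_antisymm
  · -- every finite set of points in `B` is separated by disjoint basic open sets
    have key : ∀ F : Finset (Rd d), (F : Set (Rd d)) ⊆ pointsOf ξ ∩ B →
        (F.card : ℝ≥0∞) ≤ countOfHits (fun C => ξ C ≠ 0) B := by
      intro F hF
      obtain ⟨U, hU, hUd⟩ := F.finite_toSet.t2_separation
      have hV : ∀ x : Rd d, ∃ V : TopologicalSpace.countableBasis (Rd d),
          x ∈ (V : Set (Rd d)) ∧ (V : Set (Rd d)) ⊆ U x := fun x => by
        obtain ⟨V, hV, hxV, hVU⟩ :=
          (TopologicalSpace.isBasis_countableBasis (Rd d)).exists_subset_of_mem_open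
            (hU x).1 (hU x).2
        exact ⟨⟨V, hV⟩, hxV, hVU⟩
      choose V hxV hVU using hV
      have hinj : Set.InjOn V F := by
        intro x hx y hy hxy
        by_contra hne
        exact Set.disjoint_left.1 (hUd hx hy hne) (hVU x (hxV x)) (hVU y (hxy ▸ hxV x))
      have hcard : (F.image V).card = F.card := Finset.card_image_of_injOn hinj
      rw [← hcard]
      refine le_iSup_of_le (F.image V) ?_
      rw [if_pos]
      refine ⟨?_, ?_⟩
      · intro a ha b hb hab
        simp only [Finset.coe_image, Set.mem_image] at ha hb
        obtain ⟨x, hx, rfl⟩ := ha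
        obtain ⟨y, hy, rfl⟩ := hb
        exact (hUd hx hy (fun h => hab (h ▸ rfl))).mono (hVU x) (hVU y)
      · intro W hW
        obtain ⟨x, hx, rfl⟩ := Finset.mem_image.1 hW
        exact hξ.measure_ne_zero_iff.2 ⟨x, (hF hx).1, (hF hx).2, hxV x⟩
    by_cases hfin : (pointsOf ξ ∩ B).Finite
    · refine le_trans ?_ (key hfin.toFinset (by simp))
      have h0 : ξ (B \ (pointsOf ξ ∩ B)) = 0 :=
        hξ.measure_eq_zero_of_disjoint (Set.disjoint_left.2 fun x hx hxB => hxB.2 ⟨hx, hxB.1⟩)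
      calc ξ B ≤ ξ ((B \ (pointsOf ξ ∩ B)) ∪ (pointsOf ξ ∩ B)) :=
            measure_mono (by rw [Set.sdiff_union_self]; exact Set.subset_union_left)
        _ ≤ ξ (B \ (pointsOf ξ ∩ B)) + ξ (pointsOf ξ ∩ B) := measure_union_le _ _
        _ = ξ (⋃ x ∈ hfin.toFinset, {x}) := by rw [h0, zero_add]; congr 1; ext; simp
        _ ≤ ∑ x ∈ hfin.toFinset, ξ {x} := measure_biUnion_finset_le _ _
        _ ≤ ∑ x ∈ hfin.toFinset, 1 := Finset.sum_le_sum fun x _ => hξ.simple x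
        _ = _ := by simp
    · have htop : countOfHits (fun C => ξ C ≠ 0) B = ∞ := by
        refine ENNReal.eq_top_of_forall_nnreal_le fun r => ?_
        obtain ⟨n, hn⟩ := exists_nat_ge r
        obtain ⟨F, hF, hFc⟩ := Set.Infinite.exists_subset_card_eq hfin n
        refine le_trans ?_ (key F hF)
        rw [hFc]
        exact_mod_cast hn
      rw [htop]; exact le_top
  · refine iSup_le fun s => ?_
    split_ifs with h
    · calc (s.card : ℝ≥0∞) = ∑ U ∈ s, 1 := by simp
        _ ≤ ∑ U ∈ s, ξ (B ∩ U) := Finset.sum_le_sum fun U hU =>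
            hξ.one_le_of_ne_zero (B.2.inter (measurableSet_coe_countableBasis U)) (h.2 U hU)
        _ = ξ (⋃ U ∈ s, (B ∩ U : Set (Rd d))) := by
            refine (measure_biUnion_finset ?_ ?_).symm
            · intro a ha b hb hab
              exact (h.1 ha hb hab).mono Set.inter_subset_right Set.inter_subset_right
            · exact fun U _ => B.2.inter (measurableSet_coe_countableBasis U)
        _ ≤ ξ B := measure_mono (Set.iUnion₂_subset fun _ _ => Set.inter_subset_left)
    · exact zero_le

/-! ### Hitting a set by a translated grain -/

theorem measurable_restrict_measure {α : Type*} [MeasurableSpace α] {A : Set α}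
    (hA : MeasurableSet A) : Measurable fun μ : Measure α => μ.restrict A := by
  refine Measure.measurable_of_measurable_coe _ fun s hs => ?_
  simp only [Measure.restrict_apply hs]
  exact Measure.measurable_coe (hs.inter hA)

/-- The restriction of `ξ` to the ball of radius `n`, replaced by zero where that ball has mass
above `m`. Truncation makes it a finite kernel in `ξ`, which gives joint measurability in `ξ` and in
a translation; the identity on all measures is not an s-finite kernel. -/
noncomputable def truncKernel (d n m : ℕ) : Kernel (Measure (Rd d)) (Rd d) where
  toFun ξ := if ξ (Metric.ball 0 n) ≤ m then ξ.restrict (Metric.ball 0 n) else 0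
  measurable' := by
    refine Measurable.ite ?_ (measurable_restrict_measure Metric.isOpen_ball.measurableSet)
      measurable_const
    exact measurableSet_le (Measure.measurable_coe Metric.isOpen_ball.measurableSet)
      measurable_const

theorem truncKernel_apply {d : ℕ} (n m : ℕ) (ξ : Measure (Rd d)) : truncKernel d n m ξ =
    if ξ (Metric.ball 0 n) ≤ m then ξ.restrict (Metric.ball 0 n) else 0 := rfl

instance (d n m : ℕ) : IsFiniteKernel (truncKernel d n m) := by
  refine ⟨m, by simp, fun ξ => ?_⟩
  rw [truncKernel_apply]
  split_ifs with h
  · simpa using h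
  · simp

/-- The pairs of a germ `x` and a grain `ξ` such that `x + ξ` hits `C`, up to truncation of the
grain; see `mem_hitSet_iff` for locally finite grains. -/
def hitSet {d : ℕ} (C : Set (Rd d)) : Set (Rd d × Measure (Rd d)) :=
  {p | ∃ n m : ℕ, truncKernel d n m p.2 ((fun y => p.1 + y) ⁻¹' C) ≠ 0}

theorem measurableSet_hitSet {d : ℕ} {C : Set (Rd d)} (hC : MeasurableSet C) :
    MeasurableSet (hitSet C) := by
  have h : ∀ n m : ℕ, Measurable (fun p : Rd d × Measure (Rd d) =>
      truncKernel d n m p.2 ((fun y => p.1 + y) ⁻¹' C)) := fun n m => by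
    have hT : MeasurableSet {q : (Rd d × Measure (Rd d)) × Rd d | q.1.1 + q.2 ∈ C} :=
      (measurable_fst.fst.add measurable_snd) hC
    exact Kernel.measurable_kernel_prodMk_left
      (κ := (truncKernel d n m).comap Prod.snd measurable_snd) hT
  have : hitSet C = ⋃ n, ⋃ m, {p : Rd d × Measure (Rd d) |
      truncKernel d n m p.2 ((fun y => p.1 + y) ⁻¹' C) ≠ 0} := by
    ext p; simp [hitSet]
  rw [this]
  exact MeasurableSet.iUnion fun n => MeasurableSet.iUnion fun m =>
    (h n m) (MeasurableSet.compl (measurableSet_singleton 0))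

theorem ne_zero_of_mem_hitSet {d : ℕ} {C : Set (Rd d)} {x : Rd d} {ξ : Measure (Rd d)}
    (h : (x, ξ) ∈ hitSet C) : ξ ((fun y => x + y) ⁻¹' C) ≠ 0 := by
  obtain ⟨n, m, h⟩ := h
  contrapose! h
  rw [truncKernel_apply]
  split_ifs
  · exact le_antisymm ((Measure.restrict_apply_le _ _).trans h.le) zero_le
  · simp

theorem mem_hitSet_iff {d : ℕ} {C : Set (Rd d)} {x : Rd d} {ξ : Measure (Rd d)}
    [IsLocallyFiniteMeasure ξ] : (x, ξ) ∈ hitSet C ↔ ξ ((fun y => x + y) ⁻¹' C) ≠ 0 := by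
  refine ⟨ne_zero_of_mem_hitSet, fun h => ?_⟩
  by_contra hn
  simp only [hitSet, Set.mem_ofPred_eq, not_exists, not_not] at hn
  refine h ?_
  rw [← Set.inter_univ ((fun y => x + y) ⁻¹' C), ← Metric.iUnion_ball_nat (0 : Rd d),
    Set.inter_iUnion]
  refine measure_iUnion_null fun n => ?_
  have hfin : ξ (Metric.ball 0 n) < ∞ := measure_ball_lt_top
  obtain ⟨m, hm⟩ := ENNReal.exists_nat_gt hfin.ne
  have := hn n m
  rw [truncKernel_apply, if_pos hm.le] at this
  exact le_antisymm ((Measure.le_restrict_apply _ _).trans this.le) zero_le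

theorem hitSet_mono {d : ℕ} {C D : Set (Rd d)} (h : C ⊆ D) : hitSet C ⊆ hitSet D := by
  rintro p ⟨n, m, hp⟩
  exact ⟨n, m, fun h0 => hp (measure_mono_null (Set.preimage_mono h) h0)⟩

theorem hitSet_union {d : ℕ} (C D : Set (Rd d)) : hitSet (C ∪ D) = hitSet C ∪ hitSet D := by
  refine Set.Subset.antisymm ?_ (Set.union_subset (hitSet_mono Set.subset_union_left)
    (hitSet_mono Set.subset_union_right))
  rintro p ⟨n, m, hp⟩
  by_contra hn
  simp only [hitSet, Set.mem_union, Set.mem_ofPred_eq, not_or, not_exists, not_not] at hn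
  exact hp (by rw [Set.preimage_union]; exact measure_union_null (hn.1 n m) (hn.2 n m))

/-! ### The mixing coefficient and couplings -/

theorem totalVariation_univ_le {α : Type*} [MeasurableSpace α] (s : SignedMeasure α) (ε : ℝ)
    (h : ∀ E, MeasurableSet E → |s E| ≤ ε) : s.totalVariation univ ≤ ENNReal.ofReal (2 * ε) := by
  obtain ⟨i, hi, hpos, hneg, hp, hn⟩ := s.toJordanDecomposition_spec
  have h0 : 0 ≤ ε := (abs_nonneg _).trans (h ∅ MeasurableSet.empty)
  rw [SignedMeasure.totalVariation, Measure.add_apply, hp, hn, ← ofReal_measureReal,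
    ← ofReal_measureReal, SignedMeasure.toMeasureOfZeroLE_real_apply _ hpos hi MeasurableSet.univ,
    SignedMeasure.toMeasureOfLEZero_real_apply _ hneg hi.compl MeasurableSet.univ, two_mul,
    ENNReal.ofReal_add h0 h0]
  refine add_le_add (ENNReal.ofReal_le_ofReal ?_) (ENNReal.ofReal_le_ofReal ?_)
  · exact (le_abs_self _).trans (h _ (hi.inter MeasurableSet.univ))
  · exact (neg_le_abs _).trans (h _ (hi.compl.inter MeasurableSet.univ))

/-- The evaluations of a measure on the Borel sets. -/
def evalBorel {d : ℕ} (ξ : Measure (Rd d)) (B : BorelSets d) : ℝ≥0∞ := ξ B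

theorem measurable_evalBorel {d : ℕ} : Measurable (evalBorel (d := d)) :=
  measurable_pi_iff.2 fun B => Measure.measurable_coe B.2

/-- The σ-algebra on measures is the one induced by the evaluations, so that measurable sets of
measures can be tested on families of numbers that need not come from a measure. -/
theorem comap_evalBorel {d : ℕ} :
    MeasurableSpace.comap (evalBorel (d := d)) MeasurableSpace.pi =
      Measure.instMeasurableSpace := by
  refine le_antisymm measurable_evalBorel.comap_le ?_
  refine iSup₂_le fun s hs => ?_
  rintro _ ⟨t, ht, rfl⟩
  exact ⟨(fun f => f ⟨s, hs⟩) ⁻¹' t, measurable_pi_apply _ ht, rfl⟩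

theorem exists_evalBorel_preimage_prod {d : ℕ} {E : Set (Measure (Rd d) × Measure (Rd d))}
    (hE : MeasurableSet E) : ∃ E' : Set ((BorelSets d → ℝ≥0∞) × (BorelSets d → ℝ≥0∞)),
      MeasurableSet E' ∧ Prod.map evalBorel evalBorel ⁻¹' E' = E := by
  have : (Prod.instMeasurableSpace : MeasurableSpace (Measure (Rd d) × Measure (Rd d))) =
      MeasurableSpace.comap (Prod.map evalBorel evalBorel) Prod.instMeasurableSpace := by
    simp only [Prod.instMeasurableSpace, MeasurableSpace.prod, MeasurableSpace.comap_sup,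
      MeasurableSpace.comap_comp]
    conv_lhs => rw [← comap_evalBorel]
    simp only [MeasurableSpace.comap_comp]
    rfl
  rw [this] at hE
  exact hE

theorem abs_measureReal_preimage_sub_le {Ω γ : Type*} [MeasurableSpace Ω] (P : Measure Ω)
    [IsFiniteMeasure P] {f g : Ω → γ} {N : Set Ω} (h : ∀ ω, ω ∉ N → f ω = g ω) (E : Set γ) :
    |P.real (f ⁻¹' E) - P.real (g ⁻¹' E)| ≤ P.real N := by
  have key : ∀ f g : Ω → γ, (∀ ω, ω ∉ N → f ω = g ω) →
      P.real (f ⁻¹' E) ≤ P.real (g ⁻¹' E) + P.real N := fun f g h => by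
    refine (measureReal_mono ?_).trans (measureReal_union_le _ _)
    intro ω hω
    by_cases hN : ω ∈ N
    · exact Or.inr hN
    · exact Or.inl (by rw [Set.mem_preimage, ← h ω hN]; exact hω)
  have h1 := key f g h
  have h2 := key g f fun ω hω => (h ω hω).symm
  exact abs_sub_le_iff.2 ⟨by linarith, by linarith⟩

/-- Coupling bound: if the evaluations of `Ξ_A` and `Ξ_B` agree with independent families off the
events `M` and `N`, then `β_{A,B}` is at most twice the total probability of these events. The
coupling is used once for the joint law and once for the product law, realised on `Ω × Ω`. -/
theorem betaMixing_le_of_coupling {d : ℕ} {Ω : Type*} [MeasurableSpace Ω] (P : Measure Ω)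
    [IsProbabilityMeasure P] {Ξ : Ω → Measure (Rd d)} (hΞ : Measurable Ξ) {A B : Set (Rd d)}
    (hA : MeasurableSet A) (hB : MeasurableSet B) {U V : Ω → BorelSets d → ℝ≥0∞}
    (hU : Measurable U) (hV : Measurable V) (hUV : IndepFun U V P) {M N : Set Ω}
    (hM : ∀ ω, ω ∉ M → evalBorel ((Ξ ω).restrict A) = U ω)
    (hN : ∀ ω, ω ∉ N → evalBorel ((Ξ ω).restrict B) = V ω) :
    betaMixing P Ξ A B ≤ 2 * (P M + P N) := by
  have mA : Measurable fun ω => (Ξ ω).restrict A := (measurable_restrict_measure hA).comp hΞ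
  have mB : Measurable fun ω => (Ξ ω).restrict B := (measurable_restrict_measure hB).comp hΞ
  set p := P.real M + P.real N with hp
  have hpp : P M + P N = ENNReal.ofReal p := by
    rw [hp, ENNReal.ofReal_add measureReal_nonneg measureReal_nonneg, ofReal_measureReal,
      ofReal_measureReal]
  have key : ∀ E : Set (Measure (Rd d) × Measure (Rd d)), MeasurableSet E →
      |((P.map (fun ω => ((Ξ ω).restrict A, (Ξ ω).restrict B))).toSignedMeasure -
        ((P.map (fun ω => (Ξ ω).restrict A)).prod
          (P.map (fun ω => (Ξ ω).restrict B))).toSignedMeasure) E| ≤ 2 * p := by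
    intro E hE
    rw [Measure.toSignedMeasure_sub_apply hE]
    obtain ⟨E', hE', rfl⟩ := exists_evalBorel_preimage_prod hE
    have h1 : (P.map (fun ω => ((Ξ ω).restrict A, (Ξ ω).restrict B))).real
        (Prod.map evalBorel evalBorel ⁻¹' E') = P.real ((fun ω => (evalBorel ((Ξ ω).restrict A),
          evalBorel ((Ξ ω).restrict B))) ⁻¹' E') := by
      rw [map_measureReal_apply (mA.prodMk mB) hE]; rfl
    have h2 : ((P.map (fun ω => (Ξ ω).restrict A)).prod
          (P.map (fun ω => (Ξ ω).restrict B))).real (Prod.map evalBorel evalBorel ⁻¹' E') =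
        (P.prod P).real ((fun ω : Ω × Ω => (evalBorel ((Ξ ω.1).restrict A),
          evalBorel ((Ξ ω.2).restrict B))) ⁻¹' E') := by
      rw [Measure.map_prod_map _ _ mA mB, map_measureReal_apply (mA.prodMap mB) hE]; rfl
    have h3 : P.real ((fun ω => (U ω, V ω)) ⁻¹' E') =
        (P.prod P).real ((fun ω : Ω × Ω => (U ω.1, V ω.2)) ⁻¹' E') := by
      rw [← map_measureReal_apply (hU.prodMk hV) hE',
        (indepFun_iff_map_prod_eq_prod_map_map hU.aemeasurable hV.aemeasurable).1 hUV,
        Measure.map_prod_map _ _ hU hV, map_measureReal_apply (hU.prodMap hV) hE']; rfl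
    have h4 := abs_measureReal_preimage_sub_le P (N := M ∪ N)
      (f := fun ω => (evalBorel ((Ξ ω).restrict A), evalBorel ((Ξ ω).restrict B)))
      (g := fun ω => (U ω, V ω)) (fun ω hω => by
        rw [Set.mem_union, not_or] at hω
        simp only [hM ω hω.1, hN ω hω.2]) E'
    have h5 := abs_measureReal_preimage_sub_le (P.prod P) (N := M ×ˢ univ ∪ univ ×ˢ N)
      (f := fun ω : Ω × Ω => (evalBorel ((Ξ ω.1).restrict A), evalBorel ((Ξ ω.2).restrict B)))
      (g := fun ω : Ω × Ω => (U ω.1, V ω.2)) (fun ω hω => by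
        simp only [Set.mem_union, Set.mem_prod, Set.mem_univ, and_true, true_and, not_or] at hω
        simp only [hM ω.1 hω.1, hN ω.2 hω.2]) E'
    have h6 : P.real (M ∪ N) ≤ p := measureReal_union_le _ _
    have h7 : (P.prod P).real (M ×ˢ univ ∪ univ ×ˢ N) ≤ p := by
      refine (measureReal_union_le _ _).trans ?_
      rw [measureReal_prod_prod, measureReal_prod_prod]; simp [hp]
    rw [h1, h2]
    rw [h3] at h4
    rw [abs_le] at *
    constructor <;> linarith [h4.1, h4.2, h5.1, h5.2]
  unfold betaMixing
  refine ENNReal.div_le_of_le_mul ((totalVariation_univ_le _ _ key).trans (le_of_eq ?_))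
  rw [hpp, ENNReal.ofReal_mul zero_le_two, ENNReal.ofReal_mul zero_le_two]
  simp [mul_comm]

/-! ### Independence of a Poisson process over disjoint sets -/

theorem IsPoissonProcess.indepFun_measure_inter {d : ℕ} {Ω : Type*} [MeasurableSpace Ω]
    {P : Measure Ω} [IsProbabilityMeasure P] {N : Ω → Measure (Rd d)} (hN : IsPoissonProcess P N)
    (hm : Measurable N) {A B : Set (Rd d)} (hA : MeasurableSet A) (hB : MeasurableSet B)
    (hAB : Disjoint A B) :
    IndepFun (fun ω (C : BorelSets d) => N ω (C ∩ A))
      (fun ω (C : BorelSets d) => N ω (C ∩ B)) P := by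
  classical
  refine IndepFun.process_indepFun_process
    (fun C => (Measure.measurable_coe (C.2.inter hA)).comp hm)
    (fun C => (Measure.measurable_coe (C.2.inter hB)).comp hm) fun I J => ?_
  obtain ⟨-, -, -, hind⟩ := hN
  -- the atoms of the algebras generated by `I` on `A` and by `J` on `B`
  let atom (K : Finset (BorelSets d)) (D : Set (Rd d)) (S : Set K) : Set (Rd d) :=
    {x | x ∈ D ∧ ∀ i : K, x ∈ i.1.1 ↔ i ∈ S}
  have hatom : ∀ K D S, MeasurableSet D → MeasurableSet (atom K D S) := fun K D S hD => by
    refine measurableSet_setOfPred.2 (Measurable.and (measurableSet_setOfPred.1 hD) ?_)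
    exact Measurable.forall fun i => Measurable.iff (measurableSet_setOfPred.1 i.1.2)
      measurable_const
  have hdisj : ∀ K D S T, S ≠ T → Disjoint (atom K D S) (atom K D T) := fun K D S T hST => by
    refine Set.disjoint_left.2 fun x hx hy => hST (Set.ext fun i => ?_)
    rw [← hx.2 i, ← hy.2 i]
  have hsum : ∀ (K : Finset (BorelSets d)) (D : Set (Rd d)), MeasurableSet D →
      ∀ (i : K) (μ : Measure (Rd d)),
      μ (i.1.1 ∩ D) = ∑ S : Set K with i ∈ S, μ (atom K D S) := fun K D hD i μ => by
    rw [← measure_biUnion_finset (fun S _ T _ hST => hdisj K D S T hST)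
      (fun S _ => hatom K D S hD)]
    congr 1
    ext x
    simp only [Set.mem_inter_iff, Set.mem_iUnion, Finset.mem_filter, Finset.mem_univ, true_and]
    constructor
    · rintro ⟨hxi, hxD⟩
      exact ⟨{j | x ∈ j.1.1}, hxi, hxD, fun j => Iff.rfl⟩
    · rintro ⟨S, hiS, hxD, hx⟩
      exact ⟨(hx i).2 hiS, hxD⟩
  let at' : Set I ⊕ Set J → Set (Rd d) := Sum.elim (atom I A) (atom J B)
  have hmeas : ∀ k, MeasurableSet (at' k) := by
    rintro (S | S)
    exacts [hatom _ _ _ hA, hatom _ _ _ hB]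
  let e := Fintype.equivFin (Set I ⊕ Set J)
  have hi : iIndepFun (fun k ω => N ω (at' k)) P := by
    have h := (hind _ (fun i => at' (e.symm i)) (fun i => hmeas _) ?_).precomp e.injective
    · simpa using h
    · intro i j hij
      have hij' : e.symm i ≠ e.symm j := fun h => hij (e.symm.injective h)
      generalize e.symm i = k at hij'
      generalize e.symm j = l at hij'
      rcases k with S | S <;> rcases l with T | T
      · exact hdisj _ _ _ _ (fun h => hij' (h ▸ rfl))
      · exact hAB.mono (fun x hx => hx.1) (fun x hx => hx.1)
      · exact hAB.symm.mono (fun x hx => hx.1) (fun x hx => hx.1)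
      · exact hdisj _ _ _ _ (fun h => hij' (h ▸ rfl))
  have hf := hi.indepFun_finset (Finset.univ.image Sum.inl) (Finset.univ.image Sum.inr)
    (by simp [Finset.disjoint_left])
    (fun k => (Measure.measurable_coe (hmeas k)).comp hm)
  let φ (f : (Finset.univ.image (Sum.inl : Set I → Set I ⊕ Set J)) → ℝ≥0∞) (i : I) : ℝ≥0∞ :=
    ∑ S : Set I with i ∈ S, f ⟨Sum.inl S, by simp⟩
  let ψ (f : (Finset.univ.image (Sum.inr : Set J → Set I ⊕ Set J)) → ℝ≥0∞) (j : J) : ℝ≥0∞ :=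
    ∑ S : Set J with j ∈ S, f ⟨Sum.inr S, by simp⟩
  have hφ : Measurable φ :=
    measurable_pi_iff.2 fun i => Finset.measurable_fun_sum _ fun S _ => measurable_pi_apply _
  have hψ : Measurable ψ :=
    measurable_pi_iff.2 fun i => Finset.measurable_fun_sum _ fun S _ => measurable_pi_apply _
  have hc := hf.comp hφ hψ
  convert! hc using 1
  · funext ω i
    exact hsum I A hA i (N ω)
  · funext ω j
    exact hsum J B hB j (N ω)

/-- The restrictions of a Poisson process to disjoint Borel sets are independent. -/
theorem IsPoissonProcess.indepFun_restrict {d : ℕ} {Ω : Type*} [MeasurableSpace Ω]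
    {P : Measure Ω} [IsProbabilityMeasure P] {N : Ω → Measure (Rd d)} (hN : IsPoissonProcess P N)
    (hm : Measurable N) {A B : Set (Rd d)} (hA : MeasurableSet A) (hB : MeasurableSet B)
    (hAB : Disjoint A B) :
    IndepFun (fun ω => (N ω).restrict A) (fun ω => (N ω).restrict B) P := by
  have h := hN.indepFun_measure_inter hm hA hB hAB
  have hr : ∀ D : Set (Rd d), (fun ω (C : BorelSets d) => N ω (C ∩ D)) =
      evalBorel ∘ fun ω => (N ω).restrict D := fun D => by
    funext ω C
    exact (Measure.restrict_apply C.2).symm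
  rw [hr, hr, IndepFun_iff_Indep, ← MeasurableSpace.comap_comp, ← MeasurableSpace.comap_comp,
    comap_evalBorel] at h
  exact h

/-! ### Independence from avoidance probabilities -/

theorem comap_pi_eq_generateFrom_avoidance {Ω ι : Type*} (f : Ω → ι → Prop) :
    MeasurableSpace.comap f MeasurableSpace.pi =
      MeasurableSpace.generateFrom (Set.range fun i => {ω | ¬ f ω i}) := by
  apply le_antisymm
  · let m := MeasurableSpace.generateFrom (Set.range fun i => {ω | ¬ f ω i})
    refine Measurable.comap_le (measurable_pi_iff.2 fun i => measurableSet_setOfPred.1 ?_)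
    have := (MeasurableSpace.measurableSet_generateFrom (s := Set.range fun i => {ω | ¬ f ω i})
      ⟨i, rfl⟩).compl
    convert! this using 1
    ext ω
    simp
  · refine MeasurableSpace.generateFrom_le ?_
    rintro _ ⟨i, rfl⟩
    exact ⟨{F | ¬ F i}, measurableSet_setOfPred.2 (measurable_pi_apply i).not, rfl⟩

theorem isPiSystem_avoidance {Ω ι : Type*} {f : Ω → ι → Prop}
    (hf : ∀ i j, ∃ k, ∀ ω, f ω k ↔ f ω i ∨ f ω j) :
    IsPiSystem (Set.range fun i => {ω | ¬ f ω i}) := by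
  rintro _ ⟨i, rfl⟩ _ ⟨j, rfl⟩ -
  obtain ⟨k, hk⟩ := hf i j
  refine ⟨k, ?_⟩
  ext ω
  simp [hk]

/-- Two families of events are independent if each is closed under unions and avoiding a member of
the one is independent of avoiding a member of the other: the avoidance events form a π-system. -/
theorem indepFun_of_avoidance {Ω ι κ : Type*} [MeasurableSpace Ω] {P : Measure Ω}
    [IsProbabilityMeasure P] {f : Ω → ι → Prop} {g : Ω → κ → Prop} (hf : Measurable f)
    (hg : Measurable g) (hfu : ∀ i j, ∃ k, ∀ ω, f ω k ↔ f ω i ∨ f ω j)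
    (hgu : ∀ i j, ∃ k, ∀ ω, g ω k ↔ g ω i ∨ g ω j)
    (h : ∀ i j, P {ω | ¬ f ω i ∧ ¬ g ω j} = P {ω | ¬ f ω i} * P {ω | ¬ g ω j}) :
    IndepFun f g P := by
  rw [IndepFun_iff_Indep]
  refine IndepSets.indep hf.comap_le hg.comap_le (isPiSystem_avoidance hfu)
    (isPiSystem_avoidance hgu) (comap_pi_eq_generateFrom_avoidance f)
    (comap_pi_eq_generateFrom_avoidance g) ?_
  rw [IndepSets_iff]
  rintro _ _ ⟨i, rfl⟩ ⟨j, rfl⟩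
  exact h i j

/-- The function `t ↦ exp (-t)` on `[0, ∞]`. -/
noncomputable def expNeg (t : ℝ≥0∞) : ℝ≥0∞ := EReal.exp (-(t : EReal))

theorem continuous_expNeg : Continuous expNeg :=
  ENNReal.continuous_exp.comp (continuous_neg.comp continuous_coe_ennreal_ereal)

theorem expNeg_zero : expNeg 0 = 1 := by simp [expNeg]

theorem expNeg_add (s t : ℝ≥0∞) : expNeg (s + t) = expNeg s * expNeg t := by
  have h : ∀ t : ℝ≥0∞, EReal.exp (t : EReal) ≠ 0 := fun t h => by
    rw [EReal.exp_eq_zero_iff] at h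
    exact EReal.coe_ennreal_ne_bot t h
  simp only [expNeg, EReal.exp_neg, EReal.coe_ennreal_add, EReal.exp_add]
  exact ENNReal.mul_inv (Or.inl (h s)) (Or.inr (h t))

theorem expNeg_sum {ι : Type*} (s : Finset ι) (f : ι → ℝ≥0∞) :
    expNeg (∑ i ∈ s, f i) = ∏ i ∈ s, expNeg (f i) := by
  classical
  induction s using Finset.induction_on with
  | empty => simp [expNeg_zero]
  | insert a s ha ih => rw [Finset.sum_insert ha, Finset.prod_insert ha, expNeg_add, ih]

/-- The function `q ↦ -log q`, cut off at zero. -/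
noncomputable def negLog (q : ℝ≥0∞) : ℝ≥0∞ := (-ENNReal.log q).toENNReal

theorem measurable_negLog : Measurable negLog :=
  (ENNReal.measurable_log.neg).ereal_toENNReal

theorem negLog_one : negLog 1 = 0 := by simp [negLog]

theorem expNeg_negLog {q : ℝ≥0∞} (hq : q ≤ 1) : expNeg (negLog q) = q := by
  have : 0 ≤ -ENNReal.log q := by
    rw [EReal.neg_nonneg]; simpa using hq
  rw [expNeg, negLog, EReal.coe_toENNReal this, neg_neg, ENNReal.exp_log]

/-! ### Avoidance probabilities of the marked germs -/

/-- The probability that a mark with law `ν` attached to the point `x` avoids `T`. -/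
noncomputable def markAvoidProb {E F : Type*} [MeasurableSpace F] (ν : Measure F) (T : Set (E × F))
    (x : E) : ℝ≥0∞ := ν {ξ | (x, ξ) ∉ T}

theorem measurable_markAvoidProb {E F : Type*} [MeasurableSpace E] [MeasurableSpace F]
    (ν : Measure F) [SFinite ν] {T : Set (E × F)} (hT : MeasurableSet T) :
    Measurable (markAvoidProb ν T) :=
  measurable_measure_prodMk_left hT.compl

theorem markAvoidProb_le_one {E F : Type*} [MeasurableSpace F] (ν : Measure F)
    [IsProbabilityMeasure ν] (T : Set (E × F)) (x : E) : markAvoidProb ν T x ≤ 1 := prob_le_one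

section MarkedSequence

variable {E F Ω : Type*} [MeasurableSpace E] [MeasurableSpace F] [MeasurableSpace Ω]
  {P : Measure Ω} [IsProbabilityMeasure P] {X : ℕ → Ω → E} {G : ℕ → Ω → F}

/-- Given the germs, the marks avoid `T` independently of each other. -/
theorem measure_forall_lt_notMem (hX : ∀ n, Measurable (X n)) (hG : ∀ n, Measurable (G n))
    (hGi : iIndepFun G P) (hGd : ∀ n, IdentDistrib (G n) (G 0) P P)
    (hXG : IndepFun (fun ω n => X n ω) (fun ω n => G n ω) P) {T : Set (E × F)}
    (hT : MeasurableSet T) (m : ℕ) :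
    P {ω | ∀ n < m, (X n ω, G n ω) ∉ T} =
      ∫⁻ ω, ∏ n ∈ Finset.range m, markAvoidProb (P.map (G 0)) T (X n ω) ∂P := by
  have mX : Measurable fun ω n => X n ω := measurable_pi_iff.2 hX
  have mG : Measurable fun ω n => G n ω := measurable_pi_iff.2 hG
  have : IsProbabilityMeasure (P.map (G 0)) := Measure.isProbabilityMeasure_map (hG 0).aemeasurable
  have : IsProbabilityMeasure (P.map fun ω n => G n ω) :=
    Measure.isProbabilityMeasure_map mG.aemeasurable
  have hW : MeasurableSet {p : (ℕ → E) × (ℕ → F) | ∀ n < m, (p.1 n, p.2 n) ∉ T} := by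
    refine measurableSet_setOfPred.2 (Measurable.forall fun n => Measurable.forall fun _ => ?_)
    refine Measurable.not (measurableSet_setOfPred.1 ?_)
    exact (((measurable_pi_apply n).comp measurable_fst).prodMk
      ((measurable_pi_apply n).comp measurable_snd)) hT
  have h1 : P {ω | ∀ n < m, (X n ω, G n ω) ∉ T} =
      (P.map fun ω => ((fun n => X n ω), (fun n => G n ω)))
        {p | ∀ n < m, (p.1 n, p.2 n) ∉ T} := by
    rw [Measure.map_apply (mX.prodMk mG) hW]; rfl
  rw [h1, (indepFun_iff_map_prod_eq_prod_map_map mX.aemeasurable mG.aemeasurable).1 hXG,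
    Measure.prod_apply hW, lintegral_map (measurable_measure_prodMk_left hW) mX]
  refine lintegral_congr fun ω => ?_
  have hfib : ∀ n, MeasurableSet {ξ | (X n ω, ξ) ∉ T} := fun n =>
    measurable_prodMk_left hT.compl
  rw [Measure.map_apply mG (measurable_prodMk_left hW)]
  have h2 := (iIndepFun_iff_measure_inter_preimage_eq_mul.1 hGi) (Finset.range m)
    (sets := fun n => {ξ | (X n ω, ξ) ∉ T}) (fun n _ => hfib n)
  convert! h2 using 1
  · congr 1
    ext ω'
    simp
  · refine Finset.prod_congr rfl fun n _ => ?_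
    rw [markAvoidProb, ← (hGd n).map_eq, Measure.map_apply (hG n) (hfib n)]

/-- The avoidance probability is a Laplace functional of the germs: the infinite product of the
probabilities `markAvoidProb` is the exponential of a sum of logarithms. -/
theorem measure_forall_notMem (hX : ∀ n, Measurable (X n)) (hG : ∀ n, Measurable (G n))
    (hGi : iIndepFun G P) (hGd : ∀ n, IdentDistrib (G n) (G 0) P P)
    (hXG : IndepFun (fun ω n => X n ω) (fun ω n => G n ω) P) {T : Set (E × F)}
    (hT : MeasurableSet T) :
    P {ω | ∀ n, (X n ω, G n ω) ∉ T} =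
      ∫⁻ ω, expNeg (∑' n, negLog (markAvoidProb (P.map (G 0)) T (X n ω))) ∂P := by
  have : IsProbabilityMeasure (P.map (G 0)) := Measure.isProbabilityMeasure_map (hG 0).aemeasurable
  have hq : ∀ n, Measurable fun ω => markAvoidProb (P.map (G 0)) T (X n ω) := fun n =>
    (measurable_markAvoidProb _ hT).comp (hX n)
  have hl : Filter.Tendsto (fun m => P {ω | ∀ n < m, (X n ω, G n ω) ∉ T}) Filter.atTop
      (nhds (P {ω | ∀ n, (X n ω, G n ω) ∉ T})) := by
    have : {ω | ∀ n, (X n ω, G n ω) ∉ T} = ⋂ m, {ω | ∀ n < m, (X n ω, G n ω) ∉ T} := by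
      ext ω
      simp only [Set.mem_ofPred_eq, Set.mem_iInter]
      exact ⟨fun h _ n _ => h n, fun h n => h (n + 1) n n.lt_succ_self⟩
    rw [this]
    refine tendsto_measure_iInter_atTop (fun m => ?_) ?_ ⟨0, measure_ne_top _ _⟩
    · refine (measurableSet_setOfPred.2
        (Measurable.forall fun n => Measurable.forall fun _ => ?_)).nullMeasurableSet
      exact Measurable.not (measurableSet_setOfPred.1 (((hX n).prodMk (hG n)) hT))
    · exact fun a b hab ω h n hn => h n (hn.trans_le hab)
  have hr : Filter.Tendsto (fun m => P {ω | ∀ n < m, (X n ω, G n ω) ∉ T}) Filter.atTop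
      (nhds (∫⁻ ω, expNeg (∑' n, negLog (markAvoidProb (P.map (G 0)) T (X n ω))) ∂P)) := by
    simp_rw [measure_forall_lt_notMem hX hG hGi hGd hXG hT]
    refine tendsto_lintegral_of_dominated_convergence (fun _ => 1) (fun m => ?_) (fun m => ?_)
      (by simp) (Filter.Eventually.of_forall fun ω => ?_)
    · exact Finset.measurable_fun_prod _ fun n _ => hq n
    · exact Filter.Eventually.of_forall fun ω =>
        Finset.prod_le_one' fun n _ => markAvoidProb_le_one _ _ _
    · have h := (continuous_expNeg.tendsto _).comp (ENNReal.summable.hasSum.tendsto_sum_nat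
        (f := fun n => negLog (markAvoidProb (P.map (G 0)) T (X n ω))))
      refine h.congr fun m => ?_
      rw [Function.comp_apply, expNeg_sum]
      exact Finset.prod_congr rfl fun n _ => expNeg_negLog (markAvoidProb_le_one _ _ _)
  exact tendsto_nhds_unique hl hr

end MarkedSequence

/-- For a Poisson process of germs with i.i.d. marks, avoiding a set of marked points over `A` is
independent of avoiding a set of marked points over `B`, if `A` and `B` are disjoint. -/
theorem measure_avoid_and_avoid {d : ℕ} {F Ω : Type*} [MeasurableSpace F] [MeasurableSpace Ω]
    {P : Measure Ω} [IsProbabilityMeasure P] {X : ℕ → Ω → Rd d} {G : ℕ → Ω → F}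
    (hX : ∀ n, Measurable (X n)) (hG : ∀ n, Measurable (G n)) (hGi : iIndepFun G P)
    (hGd : ∀ n, IdentDistrib (G n) (G 0) P P)
    (hXG : IndepFun (fun ω n => X n ω) (fun ω n => G n ω) P)
    (hN : Measurable (germProcess X)) (hP : IsPoissonProcess P (germProcess X))
    {A B : Set (Rd d)} (hA : MeasurableSet A) (hB : MeasurableSet B) (hAB : Disjoint A B)
    {S T : Set (Rd d × F)} (hS : MeasurableSet S) (hT : MeasurableSet T)
    (hSA : ∀ p ∈ S, p.1 ∈ A) (hTB : ∀ p ∈ T, p.1 ∈ B) :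
    P {ω | (∀ n, (X n ω, G n ω) ∉ S) ∧ ∀ n, (X n ω, G n ω) ∉ T} =
      P {ω | ∀ n, (X n ω, G n ω) ∉ S} * P {ω | ∀ n, (X n ω, G n ω) ∉ T} := by
  set ν := P.map (G 0) with hν
  have : IsProbabilityMeasure ν := Measure.isProbabilityMeasure_map (hG 0).aemeasurable
  let g (U : Set (Rd d × F)) (x : Rd d) : ℝ≥0∞ := negLog (markAvoidProb ν U x)
  have hg : ∀ U, MeasurableSet U → Measurable (g U) := fun U hU =>
    measurable_negLog.comp (measurable_markAvoidProb ν hU)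
  have hg0 : ∀ (U : Set (Rd d × F)) (D : Set (Rd d)), (∀ p ∈ U, p.1 ∈ D) → ∀ x ∉ D, g U x = 0 := by
    intro U D hUD x hx
    have : {ξ | (x, ξ) ∉ U} = univ := Set.eq_univ_of_forall fun ξ h => hx (hUD _ h)
    simp only [g, markAvoidProb, this, measure_univ, negLog_one]
  have hgST : ∀ x, g (S ∪ T) x = g S x + g T x := by
    intro x
    by_cases hx : x ∈ A
    · rw [hg0 T B hTB x (Set.disjoint_left.1 hAB hx), add_zero]
      have : ∀ ξ, (x, ξ) ∉ T := fun ξ h => Set.disjoint_left.1 hAB hx (hTB _ h)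
      simp [g, markAvoidProb, this]
    · rw [hg0 S A hSA x hx, zero_add]
      have : ∀ ξ, (x, ξ) ∉ S := fun ξ h => hx (hSA _ h)
      simp [g, markAvoidProb, this]
  have hint : ∀ U D, MeasurableSet U → MeasurableSet D → (∀ p ∈ U, p.1 ∈ D) → ∀ ω,
      ∑' n, g U (X n ω) = ∫⁻ x, g U x ∂(germProcess X ω).restrict D := by
    intro U D hU hD hUD ω
    rw [← lintegral_indicator hD, germProcess, lintegral_sum_measure]
    refine tsum_congr fun n => ?_
    rw [lintegral_dirac' _ ((hg U hU).indicator hD)]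
    by_cases hx : X n ω ∈ D
    · rw [Set.indicator_of_mem hx]
    · rw [Set.indicator_of_notMem hx, hg0 U D hUD _ hx]
  have hST : {ω | (∀ n, (X n ω, G n ω) ∉ S) ∧ ∀ n, (X n ω, G n ω) ∉ T} =
      {ω | ∀ n, (X n ω, G n ω) ∉ S ∪ T} := by
    ext ω; simp [forall_and]
  rw [hST, measure_forall_notMem hX hG hGi hGd hXG (hS.union hT),
    measure_forall_notMem hX hG hGi hGd hXG hS, measure_forall_notMem hX hG hGi hGd hXG hT]
  have hind := (hP.indepFun_restrict hN hA hB hAB).comp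
    (φ := fun μ => expNeg (∫⁻ x, g S x ∂μ)) (ψ := fun μ => expNeg (∫⁻ x, g T x ∂μ))
    (continuous_expNeg.measurable.comp (Measure.measurable_lintegral (hg S hS)))
    (continuous_expNeg.measurable.comp (Measure.measurable_lintegral (hg T hT)))
  have hSm : Measurable fun ω => expNeg (∫⁻ x, g S x ∂(germProcess X ω).restrict A) :=
    (continuous_expNeg.measurable.comp (Measure.measurable_lintegral (hg S hS))).comp
      ((measurable_restrict_measure hA).comp hN)
  have hTm : Measurable fun ω => expNeg (∫⁻ x, g T x ∂(germProcess X ω).restrict B) :=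
    (continuous_expNeg.measurable.comp (Measure.measurable_lintegral (hg T hT))).comp
      ((measurable_restrict_measure hB).comp hN)
  have hmul := lintegral_mul_eq_lintegral_mul_lintegral_of_indepFun'' hSm.aemeasurable
    hTm.aemeasurable hind
  calc ∫⁻ ω, expNeg (∑' n, g (S ∪ T) (X n ω)) ∂P
      = ∫⁻ ω, expNeg (∫⁻ x, g S x ∂(germProcess X ω).restrict A) *
          expNeg (∫⁻ x, g T x ∂(germProcess X ω).restrict B) ∂P := by
        refine lintegral_congr fun ω => ?_
        simp_rw [hgST]
        rw [ENNReal.tsum_add, expNeg_add, hint S A hS hA hSA, hint T B hT hB hTB]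
    _ = (∫⁻ ω, expNeg (∑' n, g S (X n ω)) ∂P) * ∫⁻ ω, expNeg (∑' n, g T (X n ω)) ∂P := by
        rw [hmul]
        simp_rw [hint S A hS hA hSA, hint T B hT hB hTB]

/-- `x + ξ` hits `C ∩ A` for some germ `x` in `D` with grain `ξ`. -/
def germsHit {d : ℕ} {Ω : Type*} (X : ℕ → Ω → Rd d) (G : ℕ → Ω → Measure (Rd d))
    (D A : Set (Rd d)) (ω : Ω) (C : BorelSets d) : Prop :=
  ∃ n, X n ω ∈ D ∧ (X n ω, G n ω) ∈ hitSet (C ∩ A)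

theorem measurable_germsHit {d : ℕ} {Ω : Type*} [MeasurableSpace Ω] {X : ℕ → Ω → Rd d}
    {G : ℕ → Ω → Measure (Rd d)} (hX : ∀ n, Measurable (X n)) (hG : ∀ n, Measurable (G n))
    {D A : Set (Rd d)} (hD : MeasurableSet D) (hA : MeasurableSet A) :
    Measurable (germsHit X G D A) := by
  refine measurable_pi_iff.2 fun C => Measurable.exists fun n => Measurable.and ?_ ?_
  · exact measurableSet_setOfPred.1 (hX n hD)
  · exact measurableSet_setOfPred.1 (((hX n).prodMk (hG n)) (measurableSet_hitSet (C.2.inter hA)))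

/-- The hits of germs in disjoint regions are independent. -/
theorem indepFun_germsHit {d : ℕ} {Ω : Type*} [MeasurableSpace Ω]
    {P : Measure Ω} [IsProbabilityMeasure P] {X : ℕ → Ω → Rd d} {G : ℕ → Ω → Measure (Rd d)}
    {Ξ : Ω → Measure (Rd d)} (hΞ : IsBooleanModel P X G Ξ) {A' B' A B : Set (Rd d)}
    (hA' : MeasurableSet A') (hB' : MeasurableSet B') (hd : Disjoint A' B')
    (hA : MeasurableSet A) (hB : MeasurableSet B) :
    IndepFun (germsHit X G A' A) (germsHit X G B' B) P := by
  have hX := hΞ.germ_measurable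
  have hG := fun n => (hΞ.grain_isPointProcess n).measurable
  have hu : ∀ D A : Set (Rd d), ∀ C C' : BorelSets d, ∃ C'' : BorelSets d, ∀ ω,
      germsHit X G D A ω C'' ↔ germsHit X G D A ω C ∨ germsHit X G D A ω C' := by
    intro D A C C'
    refine ⟨⟨C ∪ C', C.2.union C'.2⟩, fun ω => ?_⟩
    simp only [germsHit, Set.union_inter_distrib_right, hitSet_union, Set.mem_union]
    rw [← exists_or]
    exact exists_congr fun n => and_or_left
  refine indepFun_of_avoidance (measurable_germsHit hX hG hA' hA)
    (measurable_germsHit hX hG hB' hB) (hu _ _) (hu _ _) fun C C' => ?_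
  have key := measure_avoid_and_avoid hX hG hΞ.grain_iIndepFun
    (fun n => hΞ.grain_identDistrib n 0) hΞ.germ_indepFun_grain hΞ.germ_isPointProcess.measurable
    hΞ.germ_isPoisson hA' hB' hd
    (S := (Prod.fst ⁻¹' A') ∩ hitSet (C ∩ A)) (T := (Prod.fst ⁻¹' B') ∩ hitSet (C' ∩ B))
    ((measurable_fst hA').inter (measurableSet_hitSet (C.2.inter hA)))
    ((measurable_fst hB').inter (measurableSet_hitSet (C'.2.inter hB)))
    (fun p hp => hp.1) (fun p hp => hp.1)
  simp only [germsHit, not_exists]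
  exact key

/-! ### Localisation of the germ-grain model -/

/-- Almost surely, if no germ outside `D` has a grain that reaches `A`, then the germs in `D` alone
determine the restriction of the model to `A`. -/
theorem IsGermGrainModel.evalBorel_restrict_eq {d : ℕ} {Ω : Type*} [MeasurableSpace Ω]
    {P : Measure Ω} {X : ℕ → Ω → Rd d} {G : ℕ → Ω → Measure (Rd d)} {Ξ : Ω → Measure (Rd d)}
    (hΞ : IsGermGrainModel P X G Ξ) {A D : Set (Rd d)} (hA : MeasurableSet A) :
    ∀ᵐ ω ∂P, (¬ ∃ n, X n ω ∉ D ∧ (X n ω, G n ω) ∈ hitSet A) →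
      evalBorel ((Ξ ω).restrict A) = countOfHits (germsHit X G D A ω) := by
  filter_upwards [hΞ.isPointProcess.isConfiguration, hΞ.eq_union,
    ae_all_iff.2 fun n => (hΞ.grain_isPointProcess n).isConfiguration] with ω hc hu hg hfar
  funext C
  rw [evalBorel, (hc.restrict hA).eq_countOfHits C]
  refine congrFun (countOfHits_congr fun C => ?_) C
  rw [Measure.restrict_apply C.2, hc.measure_ne_zero_iff, hu]
  constructor
  · rintro ⟨_, hx, hxC⟩
    obtain ⟨n, y, hy, rfl⟩ := Set.mem_iUnion.1 hx
    have := (hg n).locallyFinite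
    have hhit : (X n ω, G n ω) ∈ hitSet (C ∩ A) :=
      mem_hitSet_iff.2 ((hg n).measure_ne_zero_iff.2 ⟨y, hy, hxC⟩)
    refine ⟨n, ?_, hhit⟩
    by_contra hD
    exact hfar ⟨n, hD, hitSet_mono Set.inter_subset_right hhit⟩
  · rintro ⟨n, -, hhit⟩
    obtain ⟨y, hy, hyC⟩ := (hg n).measure_ne_zero_iff.1 (ne_zero_of_mem_hitSet hhit)
    exact ⟨X n ω + y, Set.mem_iUnion.2 ⟨n, y, hy, rfl⟩, hyC⟩

/-! ### The intensity of the germs and the Campbell bound -/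

/-- The intensity measure of the germs. -/
noncomputable def germIntensity {d : ℕ} {Ω : Type*} [MeasurableSpace Ω] (P : Measure Ω)
    (X : ℕ → Ω → Rd d) : Measure (Rd d) := Measure.sum fun n => P.map (X n)

theorem germIntensity_apply {d : ℕ} {Ω : Type*} [MeasurableSpace Ω] {P : Measure Ω}
    {X : ℕ → Ω → Rd d} (hX : ∀ n, Measurable (X n)) {B : Set (Rd d)} (hB : MeasurableSet B) :
    germIntensity P X B = ∫⁻ ω, germProcess X ω B ∂P := by
  simp only [germIntensity, germProcess, Measure.sum_apply _ hB]
  rw [lintegral_tsum]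
  · refine tsum_congr fun n => ?_
    rw [Measure.map_apply (hX n) hB, ← lintegral_indicator_one (hX n hB)]
    refine lintegral_congr fun ω => ?_
    rw [Measure.dirac_apply' _ hB]
    rfl
  · exact fun n => ((Measure.measurable_coe hB).comp
      (Measure.measurable_dirac.comp (hX n))).aemeasurable

theorem lintegral_natCast_poissonMeasure_ne_top (r : ℝ≥0) :
    ∫⁻ k, (k : ℝ≥0∞) ∂(poissonMeasure r) ≠ ∞ := by
  have hi : Integrable (fun k : ℕ => (k : ℝ)) (poissonMeasure r) := by
    rw [integrable_poissonMeasure_iff, ← summable_nat_add_iff 1]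
    refine ((Real.summable_pow_div_factorial (r : ℝ)).mul_left (Real.exp (-r) * r)).congr
      fun k => ?_
    rw [Nat.factorial_succ, Real.norm_natCast]
    push_cast
    have : (k.factorial : ℝ) ≠ 0 := by positivity
    have : (k : ℝ) + 1 ≠ 0 := by positivity
    field_simp
    ring
  have h := hi.hasFiniteIntegral
  rw [HasFiniteIntegral] at h
  refine ne_of_lt (lt_of_eq_of_lt (lintegral_congr fun k => ?_) h)
  rw [Real.enorm_of_nonneg (Nat.cast_nonneg k), ENNReal.ofReal_natCast]

/-- The intensity of stationary Poisson germs is a multiple of Lebesgue measure: it is invariant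
under translations, and finite on compact sets because Poisson variables have a finite mean. -/
theorem germIntensity_eq_smul_volume {d : ℕ} {Ω : Type*} [MeasurableSpace Ω] {P : Measure Ω}
    [IsProbabilityMeasure P] {X : ℕ → Ω → Rd d} (hX : ∀ n, Measurable (X n))
    (hN : Measurable (germProcess X)) (hs : IsStationaryProcess P (germProcess X))
    (hP : IsPoissonProcess P (germProcess X)) :
    ∃ c : ℝ≥0, germIntensity P X = c • (volume : Measure (Rd d)) := by
  have hinv : (germIntensity P X).IsAddLeftInvariant := by
    refine ⟨fun x => Measure.ext fun B hB => ?_⟩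
    have hpre : MeasurableSet ((fun y => x + y) ⁻¹' B) := measurable_const_add x hB
    rw [Measure.map_apply (measurable_const_add x) hB, germIntensity_apply hX hpre,
      germIntensity_apply hX hB]
    have h := ((hs (-x)).comp (Measure.measurable_coe hB)).lintegral_eq
    refine Eq.trans (lintegral_congr fun ω => ?_) h
    rw [Function.comp_apply, Measure.map_apply (measurable_sub_const _) hB]
    congr 1
    ext y
    simp [add_comm]
  have hfin : IsFiniteMeasureOnCompacts (germIntensity P X) := by
    refine ⟨fun K hK => ?_⟩
    obtain ⟨Λ, hΛ, hlaw, -⟩ := hP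
    have hm : Measurable fun ω => germProcess X ω K :=
      (Measure.measurable_coe hK.measurableSet).comp hN
    rw [germIntensity_apply hX hK.measurableSet,
      ← lintegral_map (f := fun t : ℝ≥0∞ => t) measurable_id' hm,
      hlaw K hK.measurableSet hK.measure_lt_top,
      lintegral_map measurable_id' Measurable.of_discrete]
    exact (lintegral_natCast_poissonMeasure_ne_top _).lt_top
  exact ⟨_, Measure.isAddLeftInvariant_eq_smul (germIntensity P X) volume⟩

/-- Campbell bound: the probability that a germ with its grain falls in `T` is at most the integral
of the conditional probabilities against the germ intensity. -/
theorem IsGermGrainModel.measure_exists_mem_le {d : ℕ} {Ω : Type*} [MeasurableSpace Ω]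
    {P : Measure Ω} [IsProbabilityMeasure P] {X : ℕ → Ω → Rd d} {G : ℕ → Ω → Measure (Rd d)}
    {Ξ : Ω → Measure (Rd d)} (hΞ : IsGermGrainModel P X G Ξ)
    {T : Set (Rd d × Measure (Rd d))} (hT : MeasurableSet T) (f : Rd d → ℝ≥0∞)
    (hf : ∀ n x, P {ω | (x, G n ω) ∈ T} ≤ f x) :
    P {ω | ∃ n, (X n ω, G n ω) ∈ T} ≤ ∫⁻ x, f x ∂(germIntensity P X) := by
  rw [germIntensity, lintegral_sum_measure, Set.ofPred_exists]
  refine (measure_iUnion_le _).trans (ENNReal.tsum_le_tsum fun n => ?_)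
  have hX := hΞ.germ_measurable n
  have hG := (hΞ.grain_isPointProcess n).measurable
  have := Measure.isProbabilityMeasure_map (μ := P) hG.aemeasurable
  have hind : IndepFun (X n) (G n) P :=
    hΞ.germ_indepFun_grain.comp (measurable_pi_apply n) (measurable_pi_apply n)
  have h1 : P {ω | (X n ω, G n ω) ∈ T} = (P.map fun ω => (X n ω, G n ω)) T := by
    rw [Measure.map_apply (hX.prodMk hG) hT]; rfl
  rw [h1, (indepFun_iff_map_prod_eq_prod_map_map hX.aemeasurable hG.aemeasurable).1 hind,
    Measure.prod_apply hT]
  refine lintegral_mono fun x => ?_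
  rw [Measure.map_apply hG (measurable_prodMk_left hT)]
  exact hf n x

/-- The tail bound of the grains as a bound on hitting `A` from `x`. Enlarging the constant to
`max C₁ (exp (C₂ * r₀))` makes the bound trivial, hence valid, below the radius `r₀`. -/
theorem measure_mem_hitSet_le {d : ℕ} {Ω : Type*} [MeasurableSpace Ω] {P : Measure Ω}
    [IsProbabilityMeasure P] {G : Ω → Measure (Rd d)} {r₀ C₁ C₂ : ℝ} (hC₂ : 0 < C₂)
    (htail : ∀ r : ℝ, r₀ ≤ r →
      P.real {ω | G ω (Metric.ball 0 r)ᶜ ≠ 0} ≤ C₁ * Real.exp (-C₂ * r))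
    (A : Set (Rd d)) (x : Rd d) :
    P {ω | (x, G ω) ∈ hitSet A} ≤
      ENNReal.ofReal (max C₁ (Real.exp (C₂ * r₀)) * Real.exp (-C₂ * Metric.infDist x A)) := by
  set ρ := Metric.infDist x A
  by_cases hr : r₀ ≤ ρ
  · have hsub : (fun y => x + y) ⁻¹' A ⊆ (Metric.ball 0 ρ)ᶜ := by
      intro y hy
      have := Metric.infDist_le_dist_of_mem (x := x) (Set.mem_preimage.1 hy)
      simpa [ρ] using this
    calc P {ω | (x, G ω) ∈ hitSet A} ≤ P {ω | G ω (Metric.ball 0 ρ)ᶜ ≠ 0} :=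
          measure_mono fun ω hω h0 => ne_zero_of_mem_hitSet hω (measure_mono_null hsub h0)
      _ = ENNReal.ofReal (P.real {ω | G ω (Metric.ball 0 ρ)ᶜ ≠ 0})  := by
          rw [ofReal_measureReal]
      _ ≤ _ := ENNReal.ofReal_le_ofReal ((htail ρ hr).trans
          (mul_le_mul_of_nonneg_right (le_max_left _ _) (Real.exp_pos _).le))
  · refine prob_le_one.trans ?_
    rw [← ENNReal.ofReal_one]
    refine ENNReal.ofReal_le_ofReal ?_
    calc (1 : ℝ) ≤ Real.exp (C₂ * r₀) * Real.exp (-C₂ * ρ) := by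
          rw [← Real.exp_add]
          exact Real.one_le_exp (by nlinarith)
      _ ≤ _ := mul_le_mul_of_nonneg_right (le_max_right _ _) (Real.exp_pos _).le

/-! ### Integrating the exponential tail -/

theorem lintegral_exp_neg_norm_ne_top {d : ℕ} {c : ℝ} (hc : 0 < c) :
    ∫⁻ x : Rd d, ENNReal.ofReal (Real.exp (-c * ‖x‖)) ≠ ∞ := by
  have hi : Integrable fun x : Rd d => Real.exp (-c * ‖x‖) := by
    have h := integrable_one_add_norm (E := Rd d) (μ := volume) (r := (d + 1 : ℕ)) (by simp)
    refine (h.const_mul (Real.exp c * (d + 1).factorial / c ^ (d + 1))).mono'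
      (by fun_prop) (Filter.Eventually.of_forall fun x => ?_)
    have hpos : 0 < 1 + ‖x‖ := by positivity
    have h1 := Real.pow_div_factorial_le_exp (c * (1 + ‖x‖)) (by positivity) (d + 1)
    rw [Real.norm_eq_abs, Real.abs_exp, Real.rpow_neg hpos.le, Real.rpow_natCast]
    have h2 : Real.exp (-c * ‖x‖) = Real.exp c * (Real.exp (c * (1 + ‖x‖)))⁻¹ := by
      rw [← Real.exp_neg, ← Real.exp_add]; ring_nf
    have h3 : (Real.exp (c * (1 + ‖x‖)))⁻¹ ≤ ((c * (1 + ‖x‖)) ^ (d + 1) / (d + 1).factorial)⁻¹ :=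
      inv_anti₀ (by positivity) h1
    rw [h2]
    refine (mul_le_mul_of_nonneg_left h3 (Real.exp_pos c).le).trans (le_of_eq ?_)
    rw [mul_pow]
    field_simp
  have h := hi.hasFiniteIntegral
  rw [HasFiniteIntegral] at h
  refine ne_of_lt (lt_of_eq_of_lt (lintegral_congr fun x => ?_) h)
  rw [Real.enorm_of_nonneg (Real.exp_pos _).le]

/-- The integral of `exp (-c * dist x A)` over the points at distance at least `R` from `A` is at
most `exp (-c * R / 2)` times a polynomial in the diameter of `A`. -/
theorem exists_lintegral_exp_neg_infDist_le {d : ℕ} {c : ℝ} (hc : 0 < c) :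
    ∃ K : ℝ≥0∞, K ≠ ∞ ∧ ∀ A : Set (Rd d), A.Nonempty → Metric.ediam A ≠ ∞ → ∀ R : ℝ,
      ∫⁻ x, {x | R ≤ Metric.infDist x A}.indicator
          (fun x => ENNReal.ofReal (Real.exp (-c * Metric.infDist x A))) x ≤
        K * max (Metric.ediam A ^ (d : ℝ)) 1 * ENNReal.ofReal (Real.exp (-(c / 2) * R)) := by
  set v := volume (Metric.ball (0 : Rd d) 1) with hv
  set I := ∫⁻ x : Rd d, ENNReal.ofReal (Real.exp (-(c / 4) * ‖x‖)) with hI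
  have hvfin : v ≠ ∞ := measure_ball_lt_top.ne
  have hIfin : I ≠ ∞ := lintegral_exp_neg_norm_ne_top (by positivity)
  refine ⟨2 ^ d * v + I, by finiteness, fun A hA hdiam R => ?_⟩
  obtain ⟨a, ha⟩ := hA
  set D := Metric.diam A with hD
  have hD0 : 0 ≤ D := Metric.diam_nonneg
  have hDe : Metric.ediam A = ENNReal.ofReal D := by
    rw [hD, Metric.diam, ENNReal.ofReal_toReal hdiam]
  have hbdd : Bornology.IsBounded A := Metric.isBounded_iff_ediam_ne_top.2 hdiam
  have hdist : ∀ x, ‖x - a‖ - D ≤ Metric.infDist x A := fun x => by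
    rw [Metric.le_infDist ⟨a, ha⟩]
    intro y hy
    have h1 := Metric.dist_le_diam_of_mem hbdd hy ha
    have h2 := dist_triangle x y a
    rw [← dist_eq_norm]
    linarith
  -- half of the exponent yields the factor in `R`; the rest is integrable once `x` leaves the ball
  -- of radius `2 * D` about `a`, where `infDist x A ≥ ‖x - a‖ / 2`
  have hpt : ∀ x, {x | R ≤ Metric.infDist x A}.indicator
      (fun x => ENNReal.ofReal (Real.exp (-c * Metric.infDist x A))) x ≤
      ENNReal.ofReal (Real.exp (-(c / 2) * R)) *
        ((Metric.closedBall a (2 * D)).indicator 1 x +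
          ENNReal.ofReal (Real.exp (-(c / 4) * ‖x - a‖))) := by
    intro x
    refine Set.indicator_apply_le' (fun hx => ?_) fun _ => zero_le
    have hx : R ≤ Metric.infDist x A := hx
    have hi0 : 0 ≤ Metric.infDist x A := Metric.infDist_nonneg
    have hsplit : Real.exp (-c * Metric.infDist x A) ≤
        Real.exp (-(c / 2) * R) * Real.exp (-(c / 2) * Metric.infDist x A) := by
      rw [← Real.exp_add]
      exact Real.exp_le_exp.2 (by nlinarith)
    refine (ENNReal.ofReal_le_ofReal hsplit).trans ?_
    rw [ENNReal.ofReal_mul (Real.exp_pos _).le]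
    gcongr
    by_cases hxa : x ∈ Metric.closedBall a (2 * D)
    · rw [Set.indicator_of_mem hxa]
      refine le_trans ?_ le_self_add
      rw [Pi.one_apply, ENNReal.ofReal_le_one, Real.exp_le_one_iff]
      nlinarith
    · refine le_trans (ENNReal.ofReal_le_ofReal (Real.exp_le_exp.2 ?_)) le_add_self
      rw [Metric.mem_closedBall, not_le, dist_eq_norm] at hxa
      nlinarith [hdist x]
  have hball : volume (Metric.closedBall a (2 * D)) = 2 ^ d * Metric.ediam A ^ (d : ℝ) * v := by
    rw [Measure.addHaar_closedBall _ _ (by positivity), finrank_euclideanSpace_fin, hDe,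
      ENNReal.rpow_natCast, mul_pow, ENNReal.ofReal_mul (by positivity),
      ENNReal.ofReal_pow hD0, ENNReal.ofReal_pow zero_le_two]
    simp [hv]
  have hshift : ∫⁻ x : Rd d, ENNReal.ofReal (Real.exp (-(c / 4) * ‖x - a‖)) = I :=
    lintegral_sub_right_eq_self (fun x : Rd d => ENNReal.ofReal (Real.exp (-(c / 4) * ‖x‖))) a
  calc ∫⁻ x, {x | R ≤ Metric.infDist x A}.indicator
          (fun x => ENNReal.ofReal (Real.exp (-c * Metric.infDist x A))) x
      ≤ ∫⁻ x, ENNReal.ofReal (Real.exp (-(c / 2) * R)) *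
        ((Metric.closedBall a (2 * D)).indicator 1 x +
          ENNReal.ofReal (Real.exp (-(c / 4) * ‖x - a‖))) := lintegral_mono hpt
    _ = ENNReal.ofReal (Real.exp (-(c / 2) * R)) *
          (2 ^ d * Metric.ediam A ^ (d : ℝ) * v + I) := by
        rw [lintegral_const_mul' _ _ ENNReal.ofReal_ne_top, lintegral_add_right _ (by fun_prop),
          lintegral_indicator_one Metric.isClosed_closedBall.measurableSet, hball, hshift]
    _ ≤ ENNReal.ofReal (Real.exp (-(c / 2) * R)) *
          (2 ^ d * max (Metric.ediam A ^ (d : ℝ)) 1 * v +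
            I * max (Metric.ediam A ^ (d : ℝ)) 1) := by
        gcongr
        · exact le_max_left _ _
        · exact le_mul_of_one_le_right zero_le (le_max_right _ _)
    _ = _ := by ring

/-! ### Decay of the mixing coefficient -/

/-- The restriction to the empty set is constant, hence independent of any other one. -/
theorem betaMixing_eq_zero_of_eq_empty {d : ℕ} {Ω : Type*} [MeasurableSpace Ω] (P : Measure Ω)
    [IsProbabilityMeasure P] {Ξ : Ω → Measure (Rd d)} (hΞ : Measurable Ξ) {A B : Set (Rd d)}
    (hA : MeasurableSet A) (hB : MeasurableSet B) (h : A = ∅ ∨ B = ∅) :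
    betaMixing P Ξ A B = 0 := by
  have hm : ∀ {D}, MeasurableSet D → Measurable fun ω => evalBorel ((Ξ ω).restrict D) := fun hD =>
    measurable_evalBorel.comp ((measurable_restrict_measure hD).comp hΞ)
  have h0 : ∀ ω, evalBorel ((Ξ ω).restrict ∅) = 0 := fun ω => by
    funext C; simp [evalBorel]
  have hind : IndepFun (fun ω => evalBorel ((Ξ ω).restrict A))
      (fun ω => evalBorel ((Ξ ω).restrict B)) P := by
    rcases h with rfl | rfl
    · simp_rw [h0]; exact indepFun_const_left _ _
    · simp_rw [h0]; exact indepFun_const_right _ _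
  have := betaMixing_le_of_coupling P hΞ hA hB (hm hA) (hm hB) hind (M := ∅) (N := ∅)
    (fun _ _ => rfl) (fun _ _ => rfl)
  simpa using this

theorem setDist_le {d : ℕ} {A B : Set (Rd d)} {a b : Rd d} (ha : a ∈ A) (hb : b ∈ B) :
    setDist A B ≤ edist a b := (iInf₂_le a ha).trans (iInf₂_le b hb)

/-- Neighbourhoods of `A` and `B` of half the distance between the two sets are disjoint. -/
theorem disjoint_infDist_lt {d : ℕ} {A B : Set (Rd d)} (hA : A.Nonempty) (hB : B.Nonempty) :
    Disjoint {x | Metric.infDist x A < (setDist A B).toReal / 2}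
      {x | Metric.infDist x B < (setDist A B).toReal / 2} := by
  refine Set.disjoint_left.2 fun x hx hy => ?_
  obtain ⟨a, ha, hxa⟩ := (Metric.infDist_lt_iff hA).1 hx
  obtain ⟨b, hb, hxb⟩ := (Metric.infDist_lt_iff hB).1 hy
  have h1 : (setDist A B).toReal ≤ dist a b := by
    rw [dist_edist]
    exact ENNReal.toReal_mono (edist_ne_top a b) (setDist_le ha hb)
  have h2 := dist_triangle_left a b x
  linarith

/-- A germ outside the `R`-neighbourhood of `A` has a grain reaching `A` only with exponentially
small probability. -/
theorem IsBooleanModel.exists_measure_far_hit_le {d : ℕ} {Ω : Type*} [MeasurableSpace Ω]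
    {P : Measure Ω} [IsProbabilityMeasure P] {X : ℕ → Ω → Rd d} {G : ℕ → Ω → Measure (Rd d)}
    {Ξ : Ω → Measure (Rd d)} (hΞ : IsBooleanModel P X G Ξ) {r₀ C₁ C₂ : ℝ} (hC₂ : 0 < C₂)
    (htail : ∀ (n : ℕ) (r : ℝ), r₀ ≤ r →
      P.real {ω | G n ω (Metric.ball 0 r)ᶜ ≠ 0} ≤ C₁ * Real.exp (-C₂ * r)) :
    ∃ K : ℝ≥0∞, K ≠ ∞ ∧ ∀ A : Set (Rd d), MeasurableSet A → A.Nonempty → Metric.ediam A ≠ ∞ →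
      ∀ R : ℝ, P {ω | ∃ n, X n ω ∉ {x | Metric.infDist x A < R} ∧ (X n ω, G n ω) ∈ hitSet A} ≤
        K * max (Metric.ediam A ^ (d : ℝ)) 1 * ENNReal.ofReal (Real.exp (-(C₂ / 2) * R)) := by
  obtain ⟨c, hc⟩ := germIntensity_eq_smul_volume hΞ.germ_measurable
    hΞ.germ_isPointProcess.measurable hΞ.germ_isStationary hΞ.germ_isPoisson
  obtain ⟨K, hK, hKA⟩ := exists_lintegral_exp_neg_infDist_le (d := d) hC₂
  set C := max C₁ (Real.exp (C₂ * r₀)) with hC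
  have hC0 : 0 ≤ C := (Real.exp_pos _).le.trans (le_max_right _ _)
  refine ⟨c * ENNReal.ofReal C * K, by finiteness, fun A hA hne hdiam R => ?_⟩
  have hmR : MeasurableSet {x : Rd d | Metric.infDist x A < R} :=
    measurableSet_lt (Metric.continuous_infDist_pt A).measurable measurable_const
  have h1 := hΞ.toIsGermGrainModel.measure_exists_mem_le
    (T := (Prod.fst ⁻¹' {x : Rd d | Metric.infDist x A < R}ᶜ) ∩ hitSet A)
    ((measurable_fst hmR.compl).inter (measurableSet_hitSet hA))
    (fun x => ENNReal.ofReal C * {x | R ≤ Metric.infDist x A}.indicator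
          (fun x => ENNReal.ofReal (Real.exp (-C₂ * Metric.infDist x A))) x) (fun n x => by
      by_cases hx : R ≤ Metric.infDist x A
      · rw [Set.indicator_of_mem (by exact hx), ← ENNReal.ofReal_mul hC0]
        exact (measure_mono fun ω hω => hω.2).trans
          (measure_mem_hitSet_le hC₂ (htail n) A x)
      · refine le_of_eq_of_le ?_ zero_le
        refine measure_mono_null (fun ω hω => ?_) measure_empty
        exact hω.1 (not_le.1 hx))
  refine h1.trans ?_
  rw [hc, lintegral_smul_measure, lintegral_const_mul' _ _ ENNReal.ofReal_ne_top]
  calc c • (ENNReal.ofReal C * ∫⁻ x, {x | R ≤ Metric.infDist x A}.indicator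
          (fun x => ENNReal.ofReal (Real.exp (-C₂ * Metric.infDist x A))) x)
      ≤ c • (ENNReal.ofReal C * (K * max (Metric.ediam A ^ (d : ℝ)) 1 *
          ENNReal.ofReal (Real.exp (-(C₂ / 2) * R)))) := by
        gcongr
        exact hKA A hne hdiam R
    _ = _ := by rw [ENNReal.smul_def, smul_eq_mul]; ring

theorem lemma3p4 {d : ℕ} {Ω : Type*} [MeasurableSpace Ω] (P : Measure Ω) [IsProbabilityMeasure P]
    (X : ℕ → Ω → Rd d) (G : ℕ → Ω → Measure (Rd d)) (Ξ : Ω → Measure (Rd d))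
    (hΞ : IsBooleanModel P X G Ξ)
    (r₀ C₁ C₂ : ℝ) (hr₀ : 0 < r₀) (hC₁ : 0 < C₁) (hC₂ : 0 < C₂)
    (htail : ∀ (n : ℕ) (r : ℝ), r₀ ≤ r →
      P.real {ω | G n ω (Metric.ball 0 r)ᶜ ≠ 0} ≤ C₁ * Real.exp (-C₂ * r)) :
    EDD P Ξ := by
  obtain ⟨K, hK, hfar⟩ := hΞ.exists_measure_far_hit_le hC₂ htail
  refine ⟨d, 4 * K.toReal + 1, C₂ / 4, 1, 1, by positivity, by positivity, by positivity, one_pos,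
    one_pos, fun A B hA hB hsep => ?_⟩
  by_cases hemp : A = ∅ ∨ B = ∅
  · rw [betaMixing_eq_zero_of_eq_empty P hΞ.isPointProcess.measurable hA hB hemp]
    exact zero_le
  rw [not_or, ← ne_eq, ← ne_eq, ← Set.nonempty_iff_ne_empty, ← Set.nonempty_iff_ne_empty] at hemp
  obtain ⟨hAne, hBne⟩ := hemp
  have hδ : setDist A B ≠ ∞ := by
    obtain ⟨a, ha⟩ := hAne
    obtain ⟨b, hb⟩ := hBne
    exact ne_top_of_le_ne_top (edist_ne_top a b) (setDist_le ha hb)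
  -- the separation condition forces both diameters to be finite
  have hdiam : max (Metric.ediam A) (Metric.ediam B) ≠ ∞ := by
    intro htop
    rw [htop, max_eq_left le_top, ENNReal.log_top, EReal.coe_one, one_mul, top_le_iff] at hsep
    exact hδ (EReal.coe_ennreal_eq_top_iff.1 hsep)
  have hdA : Metric.ediam A ≠ ∞ := ne_top_of_le_ne_top hdiam (le_max_left _ _)
  have hdB : Metric.ediam B ≠ ∞ := ne_top_of_le_ne_top hdiam (le_max_right _ _)
  set R := (setDist A B).toReal / 2 with hR
  have hnbhd : ∀ D : Set (Rd d), MeasurableSet {x : Rd d | Metric.infDist x D < R} := fun D =>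
    measurableSet_lt (Metric.continuous_infDist_pt D).measurable measurable_const
  have hX := hΞ.germ_measurable
  have hG := fun n => (hΞ.grain_isPointProcess n).measurable
  have hind := (indepFun_germsHit hΞ (hnbhd A) (hnbhd B) (disjoint_infDist_lt hAne hBne)
    hA hB).comp measurable_countOfHits measurable_countOfHits
  -- the exceptional event is that of a far germ reaching `D`, up to a null set
  have hexc : ∀ D : Set (Rd d), MeasurableSet D → ∃ M : Set Ω,
      (∀ ω ∉ M, evalBorel ((Ξ ω).restrict D) =
        countOfHits (germsHit X G {x | Metric.infDist x D < R} D ω)) ∧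
      P M ≤ P {ω | ∃ n, X n ω ∉ {x | Metric.infDist x D < R} ∧ (X n ω, G n ω) ∈ hitSet D} := by
    intro D hD
    have h := hΞ.toIsGermGrainModel.evalBorel_restrict_eq hD (D := {x | Metric.infDist x D < R})
    refine ⟨_, fun ω hω => not_not.1 hω, measure_mono_ae ?_⟩
    filter_upwards [h] with ω hω hM
    exact not_not.1 fun hn => hM (hω hn)
  obtain ⟨M, hM, hPM⟩ := hexc A hA
  obtain ⟨N, hN, hPN⟩ := hexc B hB
  have hβ := betaMixing_le_of_coupling P hΞ.isPointProcess.measurable hA hB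
    (measurable_countOfHits.comp (measurable_germsHit hX hG (hnbhd A) hA))
    (measurable_countOfHits.comp (measurable_germsHit hX hG (hnbhd B) hB)) hind hM hN
  set a := max (Metric.ediam A ^ (d : ℝ)) 1 with ha
  set b := max (Metric.ediam B ^ (d : ℝ)) 1 with hb
  have ha1 : 1 ≤ a := le_max_right _ _
  have hb1 : 1 ≤ b := le_max_right _ _
  set e := ENNReal.ofReal (Real.exp (-(C₂ / 2) * R)) with he
  have hexp : EReal.exp (-(((C₂ / 4 : ℝ) : EReal) * (setDist A B : EReal))) = e := by
    rw [← EReal.coe_toReal (x := (setDist A B : EReal)) (by simpa using hδ) (by simp),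
      EReal.toReal_coe_ennreal, ← EReal.coe_mul, ← EReal.coe_neg, EReal.exp_coe, he, hR]
    congr 2
    ring
  rw [hexp]
  have hK4 : 4 * K ≤ ENNReal.ofReal (4 * K.toReal + 1) := by
    rw [ENNReal.ofReal_add (by positivity) zero_le_one, ENNReal.ofReal_mul zero_le_four,
      ENNReal.ofReal_toReal hK, ENNReal.ofReal_ofNat]
    exact le_self_add
  calc betaMixing P Ξ A B ≤ 2 * (K * a * e + K * b * e) := hβ.trans (by
        gcongr
        · exact hPM.trans (hfar A hA hAne hdA R)
        · exact hPN.trans (hfar B hB hBne hdB R))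
    _ ≤ 2 * (K * (a * b) * e + K * (a * b) * e) := by
        gcongr
        · exact le_mul_of_one_le_right zero_le hb1
        · exact le_mul_of_one_le_left zero_le ha1
    _ = 4 * K * a * b * e := by ring
    _ ≤ _ := by gcongr
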